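/- Write $e(x)=e^{2\pi i x}$. Let $1<\alpha<\beta$, $\Omega=I_-\cup I_0\cup I_+$ with $I_-=(-\infty,0)$, $I_0=(1,\alpha)$, $I_+=(\beta,\infty)$, and let $\chi_-,\chi_0,\chi_+$ be the characteristic functions of these intervals. Let $0<w\le 1$, $\theta,\phi,\psi\in\mathbb R$, and $$B=\begin{pmatrix} w\,e(\phi) & -\sqrt{1-w^2}\,e(\theta-\psi)\\ \sqrt{1-w^2}\,e(\psi) & w\,e(\theta-\phi)\end{pmatrix}\in U(2).$$ For $\lambda\in\mathbb R$ let $$\psi_\lambda(x)=\bigl(a(\lambda)\chi_-(x)+\chi_0(x)+c(\lambda)\chi_+(x)\bigr)e(\lambda x)$$ be the generalized eigenfunction of the selfadjoint operator $P_B=\frac1{2\pi i}\frac{d}{dx}$ in $L^2(\Omega)$ with boundary condition $B\binom{f(1)}{f(\beta)}=\binom{f(0)}{f(\alpha)}$ (boundary values taken from inside $\Omega$); that is, $a(\lambda),c(\lambda)\in\mathbb C$ are the coefficients for which $\psi_\lambda$ satisfies this boundary condition. Put $\psi_{\lambda,+}=c(\lambda)^{-1}\psi_\lambda$ and $\psi_{\lambda,-}=a(\lambda)^{-1}\psi_\lambda$.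 Theorem 5.5. The formulas $$(V_\pm f)(\lambda)=\int_\Omega\overline{\psi_{\lambda,\pm}(x)}\,f(x)\,dx,\qquad f\in L^1(\Omega)\cap L^2(\Omega),$$ determine unique bounded operators $V_\pm:L^2(\Omega)\to L^2(\hat{\mathbb R})$, where $\hat{\mathbb R}$ is the real line with Lebesgue measure $d\lambda$. The Lax–Phillips scattering operator $\hat S=V_+V_-^*$ is unitary on $L^2(\hat{\mathbb R})$ and acts as multiplication by the function $\hat S(\lambda)=a(\lambda)^{-1}c(\lambda)$. Explicitly, for all $\lambda\in\mathbb R$, $$a(\lambda)^{-1}c(\lambda)=e\bigl(-\theta-(\beta-\alpha+1)\lambda\bigr)\,\frac{1-\sqrt{1-w^2}\,e(\psi-(\alpha-1)\lambda)}{1-\sqrt{1-w^2}\,e(-\psi+(\alpha-1)\lambda)}.$$ -/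

import Mathlib

open MeasureTheory Filter Topology
open scoped Matrix ComplexConjugate

noncomputable section

namespace TwoIntervals

/-- The character `e(x) = exp(2πix)`. -/
def e (x : ℝ) : ℂ := Complex.exp (2 * Real.pi * Complex.I * x)

/-- The left unbounded component `(-∞, 0)`. -/
def leftInterval : Set ℝ := Set.Iio 0

/-- The bounded middle component `(1, α)`. -/
def midInterval (α : ℝ) : Set ℝ := Set.Ioo 1 α

/-- The right unbounded component `(β, ∞)`. -/
def rightInterval (β : ℝ) : Set ℝ := Set.Ioi β

/-- The exterior domain `Ω = (-∞, 0) ∪ (1, α) ∪ (β, ∞)`, the complement of `[0, 1] ∪ [α, β]`. -/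
def exterior (α β : ℝ) : Set ℝ := leftInterval ∪ midInterval α ∪ rightInterval β

/-- The Hilbert space `L²(Ω)`. -/
abbrev L2Ext (α β : ℝ) : Type := Lp ℂ 2 ((volume : Measure ℝ).restrict (exterior α β))

/-- The Hilbert space `L²(ℝ)`. -/
abbrev L2Line : Type := Lp ℂ 2 (volume : Measure ℝ)

/-- The unitary boundary matrix `B(w, θ, φ, ψ)`. -/
def boundaryMatrix (w θ φ ψ : ℝ) : Matrix (Fin 2) (Fin 2) ℂ :=
  !![(w : ℂ) * e φ, -(Real.sqrt (1 - w ^ 2) : ℂ) * e (θ - ψ);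
     (Real.sqrt (1 - w ^ 2) : ℂ) * e ψ, (w : ℂ) * e (θ - φ)]

/-- `u` is a generalized eigenfunction, with spectral parameter `ξ`, of the momentum operator
`P_B = (1 / 2πi) d/dx` on `Ω` with boundary condition `B (u(1), u(β)) = (u(0), u(α))`: it solves
`u' = 2πiξ u` on `Ω`, and its one-sided boundary values, taken from inside `Ω`, exist and satisfy
the boundary condition. -/
def IsGenEigenfunction (α β : ℝ) (B : Matrix (Fin 2) (Fin 2) ℂ) (ξ : ℝ) (u : ℝ → ℂ) : Prop :=
  (∀ x ∈ exterior α β, HasDerivAt u (2 * Real.pi * Complex.I * ξ * u x) x) ∧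
  ∃ u₀ u₁ uα uβ : ℂ,
    Tendsto u (𝓝[<] 0) (𝓝 u₀) ∧ Tendsto u (𝓝[>] 1) (𝓝 u₁) ∧
    Tendsto u (𝓝[<] α) (𝓝 uα) ∧ Tendsto u (𝓝[>] β) (𝓝 uβ) ∧
    B *ᵥ ![u₁, uβ] = ![u₀, uα]

/-- The function `(a χ₋ + χ₀ + c χ₊) e_ξ`, where `χ₋, χ₀, χ₊` are the characteristic functions of
the three components of `Ω` and `e_ξ(x) = e(ξ x)`. -/
def planeWave (α β : ℝ) (a c : ℂ) (ξ x : ℝ) : ℂ :=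
  (a * leftInterval.indicator 1 x + (midInterval α).indicator 1 x
    + c * (rightInterval β).indicator 1 x) * e (ξ * x)

/-- The bounded operator `V : L²(Ω) → L²(ℝ)` is given by
`(V f)(ξ) = ⟨k_ξ, f⟩ = ∫_Ω conj (k_ξ(x)) f(x) dx`. For bounded `k_ξ` the integral converges for
`f ∈ L¹ ∩ L²`, which is dense in `L²(Ω)`; on the rest of `L²(Ω)` it is understood, as for the
Fourier transform, by continuous extension, so that this property determines `V`. -/
def IsIntegralTransform (α β : ℝ) (k : ℝ → ℝ → ℂ) (V : L2Ext α β →L[ℂ] L2Line) : Prop :=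
  ∀ f : L2Ext α β, Integrable (f : ℝ → ℂ) (volume.restrict (exterior α β)) →
    (V f : ℝ → ℂ) =ᵐ[volume] fun ξ => ∫ x in exterior α β, conj (k ξ x) * f x

/-- The kernel `ψ_{ξ,+} = c(ξ)⁻¹ ψ_ξ`, where `ψ_ξ = (a(ξ) χ₋ + χ₀ + c(ξ) χ₊) e_ξ`. -/
def outgoingWave (α β : ℝ) (a c : ℝ → ℂ) (ξ x : ℝ) : ℂ :=
  (c ξ)⁻¹ * planeWave α β (a ξ) (c ξ) ξ x

/-- The kernel `ψ_{ξ,-} = a(ξ)⁻¹ ψ_ξ`, where `ψ_ξ = (a(ξ) χ₋ + χ₀ + c(ξ) χ₊) e_ξ`. -/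
def incomingWave (α β : ℝ) (a c : ℝ → ℂ) (ξ x : ℝ) : ℂ :=
  (a ξ)⁻¹ * planeWave α β (a ξ) (c ξ) ξ x

/-- The scattering operator `Ŝ = V₊ V₋*` on `L²(ℝ)`. -/
def scatteringOp {α β : ℝ} (Vp Vm : L2Ext α β →L[ℂ] L2Line) : L2Line →L[ℂ] L2Line :=
  Vp ∘L ContinuousLinearMap.adjoint Vm

lemma e_add (x y : ℝ) : e (x + y) = e x * e y := by
  simp only [e, ← Complex.exp_add]
  congr 1
  push_cast
  ring

lemma e_zero : e 0 = 1 := by simp [e]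

lemma hasDerivAt_e_mul (ξ x : ℝ) :
    HasDerivAt (fun y : ℝ => e (ξ * y)) (2 * Real.pi * Complex.I * ξ * e (ξ * x)) x := by
  have h : HasDerivAt (fun y : ℝ => 2 * Real.pi * Complex.I * ((ξ * y : ℝ) : ℂ))
      (2 * Real.pi * Complex.I * ξ) x := by
    have := ((hasDerivAt_id x).const_mul ξ).ofReal_comp
    simpa using this.const_mul (2 * Real.pi * Complex.I : ℂ)
  have h2 := h.cexp
  exact h2.congr_deriv (mul_comm _ _)

lemma planeWave_left {α β : ℝ} (hα : 1 < α) (hβ : α < β) (a c : ℂ) (ξ : ℝ) {x : ℝ} (hx : x < 0) :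
    planeWave α β a c ξ x = a * e (ξ * x) := by
  have h1 : x ∈ leftInterval := hx
  have h2 : x ∉ midInterval α := fun h => by have := h.1; linarith
  have h3 : x ∉ rightInterval β := fun h => by have : β < x := h; linarith
  simp [planeWave, h1, h2, h3]

lemma planeWave_mid {α β : ℝ} (hβ : α < β) (a c : ℂ) (ξ : ℝ) {x : ℝ}
    (hx : 1 < x) (hx' : x < α) : planeWave α β a c ξ x = e (ξ * x) := by
  have h1 : x ∉ leftInterval := fun h => by have : x < 0 := h; linarith
  have h2 : x ∈ midInterval α := ⟨hx, hx'⟩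
  have h3 : x ∉ rightInterval β := fun h => by have : β < x := h; linarith
  simp [planeWave, h1, h2, h3]

lemma planeWave_right {α β : ℝ} (hα : 1 < α) (hβ : α < β) (a c : ℂ) (ξ : ℝ) {x : ℝ} (hx : β < x) :
    planeWave α β a c ξ x = c * e (ξ * x) := by
  have h1 : x ∉ leftInterval := fun h => by have : x < 0 := h; linarith
  have h2 : x ∉ midInterval α := fun h => by have := h.2; linarith
  have h3 : x ∈ rightInterval β := hx
  simp [planeWave, h1, h2, h3]

/-- `(a χ₋ + χ₀ + c χ₊) e_ξ` is a generalized eigenfunction exactly when `a` and `c` solve the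
linear system given by the boundary condition. -/
lemma isGenEigenfunction_planeWave_iff {α β : ℝ} (hα : 1 < α) (hβ : α < β)
    (B : Matrix (Fin 2) (Fin 2) ℂ) (ξ : ℝ) (a c : ℂ) :
    IsGenEigenfunction α β B ξ (planeWave α β a c ξ) ↔
      B *ᵥ ![e ξ, c * e (ξ * β)] = ![a, e (ξ * α)] := by
  have ce : Continuous fun y : ℝ => e (ξ * y) :=
    continuous_iff_continuousAt.2 fun x => (hasDerivAt_e_mul ξ x).continuousAt
  have t0 : Tendsto (planeWave α β a c ξ) (𝓝[<] 0) (𝓝 a) := by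
    have h : Tendsto (fun y : ℝ => a * e (ξ * y)) (𝓝[<] 0) (𝓝 (a * e (ξ * 0))) :=
      ((continuous_const.mul ce).tendsto 0).mono_left nhdsWithin_le_nhds
    rw [mul_zero, e_zero, mul_one] at h
    refine h.congr' ?_
    filter_upwards [self_mem_nhdsWithin] with x hx
    exact (planeWave_left hα hβ a c ξ hx).symm
  have t1 : Tendsto (planeWave α β a c ξ) (𝓝[>] 1) (𝓝 (e ξ)) := by
    have h : Tendsto (fun y : ℝ => e (ξ * y)) (𝓝[>] 1) (𝓝 (e (ξ * 1))) :=
      (ce.tendsto 1).mono_left nhdsWithin_le_nhds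
    rw [mul_one] at h
    refine h.congr' ?_
    filter_upwards [Ioo_mem_nhdsGT hα] with x hx
    exact (planeWave_mid hβ a c ξ hx.1 hx.2).symm
  have tα : Tendsto (planeWave α β a c ξ) (𝓝[<] α) (𝓝 (e (ξ * α))) := by
    have h : Tendsto (fun y : ℝ => e (ξ * y)) (𝓝[<] α) (𝓝 (e (ξ * α))) :=
      (ce.tendsto α).mono_left nhdsWithin_le_nhds
    refine h.congr' ?_
    filter_upwards [Ioo_mem_nhdsLT hα] with x hx
    exact (planeWave_mid hβ a c ξ hx.1 hx.2).symm
  have tβ : Tendsto (planeWave α β a c ξ) (𝓝[>] β) (𝓝 (c * e (ξ * β))) := by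
    have h : Tendsto (fun y : ℝ => c * e (ξ * y)) (𝓝[>] β) (𝓝 (c * e (ξ * β))) :=
      ((continuous_const.mul ce).tendsto β).mono_left nhdsWithin_le_nhds
    refine h.congr' ?_
    filter_upwards [self_mem_nhdsWithin] with x hx
    exact (planeWave_right hα hβ a c ξ hx).symm
  constructor
  · rintro ⟨-, u₀, u₁, uα, uβ, h0, h1, h2, h3, hB⟩
    rw [tendsto_nhds_unique h0 t0, tendsto_nhds_unique h1 t1, tendsto_nhds_unique h2 tα,
      tendsto_nhds_unique h3 tβ] at hB
    exact hB
  · intro hB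
    refine ⟨?_, _, _, _, _, t0, t1, tα, tβ, hB⟩
    rintro x ((hx | hx) | hx)
    · have hx' : x < 0 := hx
      rw [planeWave_left hα hβ a c ξ hx']
      have := (hasDerivAt_e_mul ξ x).const_mul a
      refine (this.congr_of_eventuallyEq ?_).congr_deriv (by ring)
      filter_upwards [Iio_mem_nhds hx'] with y hy
      exact planeWave_left hα hβ a c ξ hy
    · rw [planeWave_mid hβ a c ξ hx.1 hx.2]
      refine (hasDerivAt_e_mul ξ x).congr_of_eventuallyEq ?_
      filter_upwards [Ioo_mem_nhds hx.1 hx.2] with y hy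
      exact planeWave_mid hβ a c ξ hy.1 hy.2
    · have hx' : β < x := hx
      rw [planeWave_right hα hβ a c ξ hx']
      have := (hasDerivAt_e_mul ξ x).const_mul c
      refine (this.congr_of_eventuallyEq ?_).congr_deriv (by ring)
      filter_upwards [Ioi_mem_nhds hx'] with y hy
      exact planeWave_right hα hβ a c ξ hy

/-- For `0 < w ≤ 1` the coefficients of the generalized eigenfunction
`(a χ₋ + χ₀ + c χ₊) e_ξ` exist and are unique, with the expected closed form. -/
theorem isGenEigenfunction_iff_coeff {α β w : ℝ} (hα : 1 < α) (hβ : α < β) (hw : 0 < w)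
    (hw1 : w ≤ 1) (θ φ ψ ξ : ℝ) (a c : ℂ) :
    IsGenEigenfunction α β (boundaryMatrix w θ φ ψ) ξ (planeWave α β a c ξ) ↔
      a = (w : ℂ)⁻¹ * e (φ + ξ) *
          (1 - (Real.sqrt (1 - w ^ 2) : ℂ) * e (-ψ + (α - 1) * ξ)) ∧
      c = (w : ℂ)⁻¹ * e (φ - θ - (β - α) * ξ) *
          (1 - (Real.sqrt (1 - w ^ 2) : ℂ) * e (ψ - (α - 1) * ξ)) := by
  rw [isGenEigenfunction_planeWave_iff hα hβ]
  have hs : ((Real.sqrt (1 - w ^ 2) : ℝ) : ℂ) ^ 2 = 1 - (w : ℂ) ^ 2 := by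
    rw [← Complex.ofReal_pow, Real.sq_sqrt (by nlinarith)]
    push_cast
    ring
  set s : ℂ := ((Real.sqrt (1 - w ^ 2) : ℝ) : ℂ)
  have hw0 : (w : ℂ) ≠ 0 := by exact_mod_cast hw.ne'
  have ne (x : ℝ) : e x ≠ 0 := Complex.exp_ne_zero _
  have key : ∀ x y z : ℝ, z = x + y → e z = e x * e y := fun x y z h => h ▸ e_add x y
  have vec (p q r t : ℂ) : (![p, q] = ![r, t]) ↔ (p = r ∧ q = t) := by
    constructor
    · intro h
      exact ⟨congrFun h 0, congrFun h 1⟩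
    · rintro ⟨rfl, rfl⟩
      rfl
  have hmul : boundaryMatrix w θ φ ψ *ᵥ ![e ξ, c * e (ξ * β)] =
      ![(w : ℂ) * e φ * e ξ + -s * e (θ - ψ) * (c * e (ξ * β)),
        s * e ψ * e ξ + (w : ℂ) * e (θ - φ) * (c * e (ξ * β))] := by
    ext i
    fin_cases i <;> simp [boundaryMatrix, Matrix.mulVec, dotProduct, Fin.sum_univ_two, s]
  rw [hmul, vec]
  have k1 : e (φ + ξ) = e φ * e ξ := e_add _ _
  have k2 : e (φ - θ - (β - α) * ξ) * (e (θ - φ) * e (ξ * β)) = e (ξ * α) := by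
    rw [← e_add, ← e_add]
    congr 1
    ring
  have k3 : e (ψ - (α - 1) * ξ) * e (ξ * α) = e ψ * e ξ := by
    rw [← e_add, ← e_add]
    congr 1
    ring
  have k4 : e (θ - ψ) * (e (φ - θ - (β - α) * ξ) * e (ξ * β)) =
      e (φ + ξ) * e (-ψ + (α - 1) * ξ) := by
    rw [← e_add, ← e_add, ← e_add]
    congr 1
    ring
  have k5 : e (-ψ + (α - 1) * ξ) * e (ψ - (α - 1) * ξ) = 1 := by
    rw [← e_add, ← e_zero]
    congr 1
    ring
  rw [and_comm, and_comm (a := a = _)]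
  have hc : s * e ψ * e ξ + (w : ℂ) * e (θ - φ) * (c * e (ξ * β)) = e (ξ * α) ↔
      c = (w : ℂ)⁻¹ * e (φ - θ - (β - α) * ξ) * (1 - s * e (ψ - (α - 1) * ξ)) := by
    have hne : (w : ℂ) * (e (θ - φ) * e (ξ * β)) ≠ 0 :=
      mul_ne_zero hw0 (mul_ne_zero (ne _) (ne _))
    have hmulc : (w : ℂ) * (e (θ - φ) * e (ξ * β)) *
        ((w : ℂ)⁻¹ * e (φ - θ - (β - α) * ξ) * (1 - s * e (ψ - (α - 1) * ξ))) =
        e (ξ * α) - s * (e ψ * e ξ) := by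
      rw [← k3, ← k2]
      field_simp
    constructor
    · intro h
      apply mul_left_cancel₀ hne
      rw [hmulc]
      linear_combination h
    · rintro rfl
      linear_combination hmulc
  rw [hc]
  refine and_congr_right fun h => ?_
  have ha : (w : ℂ) * e φ * e ξ + -s * e (θ - ψ) * (c * e (ξ * β)) =
      (w : ℂ)⁻¹ * e (φ + ξ) * (1 - s * e (-ψ + (α - 1) * ξ)) := by
    have hww : (w : ℂ)⁻¹ * (w : ℂ) = 1 := inv_mul_cancel₀ hw0
    rw [h]
    linear_combination
      (-(w : ℂ) * k1) - s * (w : ℂ)⁻¹ * (1 - s * e (ψ - (α - 1) * ξ)) * k4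
        + s ^ 2 * (w : ℂ)⁻¹ * e (φ + ξ) * k5 + (w : ℂ)⁻¹ * e (φ + ξ) * hs
        - (w : ℂ) * e (φ + ξ) * hww
  rw [ha]
  exact eq_comm

end TwoIntervals

end

noncomputable section

namespace TwoIntervals

open scoped FourierTransform ENNReal SchwartzMap ContDiff InnerProductSpace

/-! ### Integrable functions in `L²` -/

/-! Write `p = 1/a`, `q = c/a`. The kernel of `V₋` is `(χ₋ + p χ₀ + q χ₊) e_ξ`, so `V₋` should be
the adjoint of the synthesis operator `W` that integrates `g` against this kernel: on the three
components `W g` equals `G = F⁻¹ g`, `H = F⁻¹(p g)` and `K = F⁻¹(q g)`. Since `p` and `q` are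
bounded, `W` is bounded, which gives existence; uniqueness is density of `L¹ ∩ L²`.

The point is that `W` is isometric (`norm_synthesisOp`). Divided by `a(ξ)`, the boundary condition
reads `B (e(ξ) p, e(βξ) q) = (1, e(αξ) p)`. The inverse Fourier transform turns modulations into
translations, so `B (H(x+1), K(x+β)) = (G(x), H(x+α))` for almost every `x`. As `B` preserves the
norm of `ℂ²`, comparing squared norms and integrating over `x > 0` gives `∫_1^∞ |H|² + ∫_β^∞ |K|² =
∫_0^∞ |G|² + ∫_α^∞ |H|²`. Cancelling the tail of `H` beyond `α` and adding `∫_{-∞}^0 |G|²` yields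
`‖W g‖² = ‖G‖² = ‖g‖²`.

Hence `V₋ V₋* = W* W = 1`. Because `|a| = |c|`, passing from `ψ_{ξ,-}` to `ψ_{ξ,+}` multiplies the
transform by `conj (a/c) = c/a = q`. So `V₊` is `V₋` followed by multiplication by `q`, and `V₊ V₋*`
is multiplication by the unimodular function `q`. -/

theorem dense_integrable_Lp_two {μ : Measure ℝ} :
    Dense {f : Lp ℂ 2 μ | Integrable (f : ℝ → ℂ) μ} := by
  refine (Lp.simpleFunc.denseRange (E := ℂ) (μ := μ) (p := 2) (by simp)).mono ?_
  rintro _ ⟨f, rfl⟩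
  exact ((SimpleFunc.memLp_iff_integrable (by simp) (by simp)).1 (Lp.simpleFunc.memLp f)).congr
    (Lp.simpleFunc.toSimpleFunc_eq_toFun f)

theorem clm_ext_of_integrable {μ ν : Measure ℝ} {S T : Lp ℂ 2 μ →L[ℂ] Lp ℂ 2 ν}
    (h : ∀ f : Lp ℂ 2 μ, Integrable (f : ℝ → ℂ) μ → S f =ᵐ[ν] T f) : S = T := by
  apply DFunLike.coe_injective
  exact Continuous.ext_on dense_integrable_Lp_two S.continuous T.continuous
    fun f hf => Lp.ext (h f hf)

theorem norm_sq_L2_eq_integral {μ : Measure ℝ} (f : Lp ℂ 2 μ) :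
    ‖f‖ ^ 2 = ∫ x, ‖f x‖ ^ 2 ∂μ := by
  have h := inner_self_eq_norm_sq_to_K (𝕜 := ℂ) f
  rw [L2.inner_def] at h
  have h2 : ∀ x, ⟪f x, f x⟫_ℂ = ((‖f x‖ ^ 2 : ℝ) : ℂ) := fun x => by
    rw [inner_self_eq_norm_sq_to_K]; simp
  simp only [h2, integral_complex_ofReal] at h
  apply Complex.ofReal_injective
  rw [Complex.ofReal_pow]
  exact h.symm

theorem integrable_norm_sq {μ : Measure ℝ} (f : Lp ℂ 2 μ) :
    Integrable (fun x => ‖f x‖ ^ 2) μ :=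
  (memLp_two_iff_integrable_sq_norm (Lp.aestronglyMeasurable f)).1 (Lp.memLp f)

/-! ### The Fourier transform on `L¹ ∩ L²` -/

theorem continuous_fourier_of_integrable {f : ℝ → ℂ} (hf : Integrable f) : Continuous (𝓕 f) :=
  VectorFourier.fourierIntegral_continuous Real.continuous_fourierChar
    (L := innerₗ ℝ) continuous_inner hf

theorem integral_smul_fourier_L2 (f : L2Line) (g : 𝓢(ℝ, ℂ)) :
    ∫ x, g x • (𝓕 f : L2Line) x = ∫ x, (𝓕 g) x • f x := by
  rw [← Lp.toTemperedDistribution_apply, ← Lp.fourier_toTemperedDistribution_eq,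
    TemperedDistribution.fourier_apply, Lp.toTemperedDistribution_apply]

/-- Both transforms can be moved onto a test function, so they have the same integral against every
smooth compactly supported function. This links the abstract `L²` Fourier transform to the integral
formula required of `V₊` and `V₋`. -/
theorem coeFn_fourier_L2_of_integrable (f : L2Line) (hf : Integrable (f : ℝ → ℂ)) :
    (𝓕 f : L2Line) =ᵐ[volume] 𝓕 (f : ℝ → ℂ) := by
  refine ae_eq_of_integral_contDiff_smul_eq
    ((Lp.memLp (𝓕 f : L2Line)).locallyIntegrable (by norm_num))
    (continuous_fourier_of_integrable hf).locallyIntegrable ?_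
  intro g hg hc
  have hc' : HasCompactSupport (Complex.ofRealCLM ∘ g) := hc.comp_left rfl
  have hg' : ContDiff ℝ ∞ (Complex.ofRealCLM ∘ g) := by fun_prop
  set G : 𝓢(ℝ, ℂ) := hc'.toSchwartzMap hg' with hG
  have hGx : ∀ x, G x = (g x : ℂ) := fun x => rfl
  have h1 := integral_smul_fourier_L2 f G
  have h2 : ∫ ξ, 𝓕 (G : ℝ → ℂ) ξ • f ξ = ∫ x, G x • 𝓕 (f : ℝ → ℂ) x := by
    simpa using! VectorFourier.integral_fourierIntegral_smul_eq_flip (L := innerₗ ℝ)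
      Real.continuous_fourierChar continuous_inner G.integrable hf
  rw [SchwartzMap.fourier_coe, h2] at h1
  simpa [hGx] using h1

/-! ### Multiplication operators -/

/-- Multiplication by the bounded function `h` on `L²(ℝ)`. -/
def mulOp {h : ℝ → ℂ} (hh : MemLp h ∞ volume) : L2Line →L[ℂ] L2Line :=
  (ContinuousLinearMap.mul ℂ ℂ).holderL volume ∞ 2 2 hh.toLp

theorem coeFn_mulOp {h : ℝ → ℂ} (hh : MemLp h ∞ volume) (f : L2Line) :
    mulOp hh f =ᵐ[volume] fun x => h x * f x := by
  have := (ContinuousLinearMap.mul ℂ ℂ).coeFn_holder (r := 2) hh.toLp f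
  filter_upwards [this, hh.coeFn_toLp] with x h1 h2
  simp only [mulOp, ContinuousLinearMap.holderL_apply_apply, h1, h2, ContinuousLinearMap.mul_apply']

theorem memLp_top_conj {h : ℝ → ℂ} (hh : MemLp h ∞ volume) :
    MemLp (fun x => conj (h x)) ∞ volume := hh.star

theorem adjoint_mulOp {h : ℝ → ℂ} (hh : MemLp h ∞ volume) :
    ContinuousLinearMap.adjoint (mulOp hh) = mulOp (memLp_top_conj hh) := by
  symm
  rw [ContinuousLinearMap.eq_adjoint_iff]
  intro f g
  rw [L2.inner_def, L2.inner_def]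
  refine integral_congr_ae ?_
  filter_upwards [coeFn_mulOp hh g, coeFn_mulOp (memLp_top_conj hh) f] with x h1 h2
  rw [h1, h2]
  simp only [RCLike.inner_apply, map_mul, Complex.conj_conj]
  ring

theorem mulOp_mem_unitary {h : ℝ → ℂ} (hh : MemLp h ∞ volume) (h1 : ∀ x, ‖h x‖ = 1) :
    mulOp hh ∈ unitary (L2Line →L[ℂ] L2Line) := by
  have key : ∀ x, conj (h x) * h x = 1 := fun x => by
    rw [Complex.conj_mul', h1]; simp
  rw [Unitary.mem_iff, ContinuousLinearMap.star_eq_adjoint, adjoint_mulOp]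
  constructor <;> ext1 f <;> apply Lp.ext
  · filter_upwards [coeFn_mulOp (memLp_top_conj hh) (mulOp hh f), coeFn_mulOp hh f] with x h2 h3
    rw [mul_apply_eq_comp, h2, h3, ← mul_assoc, key, one_mul]; rfl
  · filter_upwards [coeFn_mulOp hh (mulOp (memLp_top_conj hh) f),
      coeFn_mulOp (memLp_top_conj hh) f] with x h2 h3
    rw [mul_apply_eq_comp, h2, h3, ← mul_assoc, mul_comm (h x), key, one_mul]; rfl

/-! ### The character `e` -/

theorem norm_e (x : ℝ) : ‖e x‖ = 1 := by
  rw [e, show 2 * (Real.pi : ℂ) * Complex.I * x = ((2 * Real.pi * x : ℝ) : ℂ) * Complex.I by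
    push_cast; ring]
  exact Complex.norm_exp_ofReal_mul_I _

theorem e_ne_zero (x : ℝ) : e x ≠ 0 := Complex.exp_ne_zero _

theorem conj_e (x : ℝ) : conj (e x) = e (-x) := by
  rw [e, e, ← Complex.exp_conj]
  congr 1
  simp only [map_mul, Complex.conj_ofReal, Complex.conj_I, map_ofNat, Complex.ofReal_neg]
  ring

theorem continuous_e : Continuous e := by
  unfold e
  fun_prop

theorem fourierChar_eq_e (x : ℝ) : (Real.fourierChar x : ℂ) = e x := by
  rw [Real.fourierChar_apply, e]
  congr 1
  push_cast
  ring

theorem fourier_eq_integral_e (f : ℝ → ℂ) (ξ : ℝ) :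
    𝓕 f ξ = ∫ x, conj (e (ξ * x)) * f x := by
  rw [Real.fourier_eq]
  refine integral_congr_ae (.of_forall fun x => ?_)
  simp only [Circle.smul_def, fourierChar_eq_e, conj_e, smul_eq_mul]
  rfl

theorem memLp_top_of_continuous_of_bound {h : ℝ → ℂ} (hc : Continuous h) {C : ℝ}
    (hb : ∀ x, ‖h x‖ ≤ C) : MemLp h ∞ volume :=
  memLp_top_of_bound hc.aestronglyMeasurable C (.of_forall hb)

theorem memLp_top_e (h : ℝ) : MemLp (fun ξ => e (h * ξ)) ∞ volume :=
  memLp_top_of_continuous_of_bound (continuous_e.comp (continuous_const.mul continuous_id))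
    fun _ => (norm_e _).le

/-! ### Translations -/

/-- The translation `f ↦ f (· + h)` on `L²(ℝ)`. -/
def translateOp (h : ℝ) : L2Line →L[ℂ] L2Line :=
  (Lp.compMeasurePreservingₗᵢ ℂ (· + h)
    (measurePreserving_add_right volume h)).toContinuousLinearMap

theorem coeFn_translateOp (h : ℝ) (f : L2Line) :
    translateOp h f =ᵐ[volume] fun x => f (x + h) :=
  Lp.coeFn_compMeasurePreserving f (measurePreserving_add_right volume h)

/-- The Fourier transform on `L²(ℝ)` as a bounded operator. -/
def fourierOp : L2Line →L[ℂ] L2Line :=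
  (Lp.fourierTransformₗᵢ ℝ ℂ).toContinuousLinearEquiv.toContinuousLinearMap

/-- The inverse Fourier transform on `L²(ℝ)` as a bounded operator. -/
def fourierInvOp : L2Line →L[ℂ] L2Line :=
  (Lp.fourierTransformₗᵢ ℝ ℂ).symm.toContinuousLinearEquiv.toContinuousLinearMap

theorem adjoint_fourierOp : ContinuousLinearMap.adjoint fourierOp = fourierInvOp :=
  LinearIsometryEquiv.adjoint_eq_symm _

theorem fourierOp_fourierInvOp (f : L2Line) : fourierOp (fourierInvOp f) = f :=
  (Lp.fourierTransformₗᵢ ℝ ℂ).apply_symm_apply f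

theorem fourierInvOp_fourierOp (f : L2Line) : fourierInvOp (fourierOp f) = f :=
  (Lp.fourierTransformₗᵢ ℝ ℂ).symm_apply_apply f

theorem norm_fourierInvOp (f : L2Line) : ‖fourierInvOp f‖ = ‖f‖ :=
  (Lp.fourierTransformₗᵢ ℝ ℂ).symm.norm_map f

theorem coeFn_fourierOp (f : L2Line) (hf : Integrable (f : ℝ → ℂ)) :
    fourierOp f =ᵐ[volume] fun ξ => ∫ x, conj (e (ξ * x)) * f x :=
  (coeFn_fourier_L2_of_integrable f hf).trans (.of_forall (fourier_eq_integral_e f))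

/-- On `L¹ ∩ L²` this is a change of variables in the Fourier integral; density extends it to `L²`.
-/
theorem fourierOp_translateOp (h : ℝ) :
    fourierOp ∘L translateOp h = mulOp (memLp_top_e h) ∘L fourierOp := by
  apply clm_ext_of_integrable
  intro f hf
  have hT := coeFn_translateOp h f
  have hTi : Integrable (translateOp h f : ℝ → ℂ) := (hf.comp_add_right h).congr hT.symm
  filter_upwards [coeFn_fourierOp _ hTi, coeFn_fourierOp f hf,
    coeFn_mulOp (memLp_top_e h) (fourierOp f)] with ξ h1 h2 h3
  simp only [ContinuousLinearMap.comp_apply]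
  rw [h1, h3, h2, ← integral_const_mul,
    ← integral_add_right_eq_self (fun x => e (h * ξ) * (conj (e (ξ * x)) * f x)) h]
  refine integral_congr_ae ?_
  filter_upwards [hT] with x hx
  rw [hx, ← mul_assoc, conj_e, conj_e, ← e_add]
  congr 2
  ring

theorem fourierInvOp_mulOp_e (h : ℝ) (g : L2Line) :
    fourierInvOp (mulOp (memLp_top_e h) g) = translateOp h (fourierInvOp g) := by
  have := congrArg fourierInvOp (DFunLike.congr_fun (fourierOp_translateOp h) (fourierInvOp g))
  simpa only [ContinuousLinearMap.comp_apply, fourierInvOp_fourierOp, fourierOp_fourierInvOp]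
    using this.symm

/-! ### Restriction and extension by zero -/

theorem measurableSet_exterior (α β : ℝ) : MeasurableSet (exterior α β) :=
  (measurableSet_Iio.union measurableSet_Ioo).union measurableSet_Ioi

/-- Restriction `L²(ℝ) → L²(Ω)`. -/
def restrictOp (α β : ℝ) : L2Line →L[ℂ] L2Ext α β :=
  LpToLpRestrictCLM ℝ ℂ ℂ volume 2 (exterior α β)

theorem coeFn_restrictOp (α β : ℝ) (f : L2Line) :
    restrictOp α β f =ᵐ[volume.restrict (exterior α β)] f :=
  LpToLpRestrictCLM_coeFn ℂ _ f

theorem coeFn_adjoint_restrictOp (α β : ℝ) (f : L2Ext α β) :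
    ContinuousLinearMap.adjoint (restrictOp α β) f =ᵐ[volume]
      (exterior α β).indicator (f : ℝ → ℂ) := by
  have hm : MemLp ((exterior α β).indicator (f : ℝ → ℂ)) 2 volume :=
    (memLp_indicator_iff_restrict (measurableSet_exterior α β)).2 (Lp.memLp f)
  have : ContinuousLinearMap.adjoint (restrictOp α β) f = hm.toLp := by
    refine ext_inner_right ℂ fun g => ?_
    rw [ContinuousLinearMap.adjoint_inner_left, L2.inner_def, L2.inner_def,
      ← integral_indicator (measurableSet_exterior α β)]
    refine integral_congr_ae ?_
    filter_upwards [hm.coeFn_toLp,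
      ae_imp_of_ae_restrict (coeFn_restrictOp α β g)] with x h1 h2
    rw [h1]
    by_cases hx : x ∈ exterior α β
    · simp [hx, h2 hx]
    · simp [hx]
  rw [this]
  exact hm.coeFn_toLp

theorem memLp_top_indicator {s : Set ℝ} (hs : MeasurableSet s) :
    MemLp (s.indicator (1 : ℝ → ℂ)) ∞ volume :=
  memLp_top_of_bound (aestronglyMeasurable_const.indicator hs) 1 (.of_forall fun x => by
    by_cases hx : x ∈ s <;> simp [hx])

/-! ### The synthesis operator -/

theorem measurableSet_leftInterval : MeasurableSet leftInterval := measurableSet_Iio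

theorem measurableSet_midInterval (α : ℝ) : MeasurableSet (midInterval α) := measurableSet_Ioo

theorem measurableSet_rightInterval (β : ℝ) : MeasurableSet (rightInterval β) := measurableSet_Ioi

/-- Multiplication by the characteristic function of `s`. -/
def indicatorOp {s : Set ℝ} (hs : MeasurableSet s) : L2Line →L[ℂ] L2Line :=
  mulOp (memLp_top_indicator hs)

theorem coeFn_indicatorOp {s : Set ℝ} (hs : MeasurableSet s) (f : L2Line) :
    indicatorOp hs f =ᵐ[volume] fun x => s.indicator 1 x * f x :=
  coeFn_mulOp (memLp_top_indicator hs) f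

theorem adjoint_indicatorOp {s : Set ℝ} (hs : MeasurableSet s) :
    ContinuousLinearMap.adjoint (indicatorOp hs) = indicatorOp hs := by
  rw [indicatorOp, adjoint_mulOp]
  ext1 f
  apply Lp.ext
  filter_upwards [coeFn_mulOp (memLp_top_indicator hs) f,
    coeFn_mulOp (memLp_top_conj (memLp_top_indicator hs)) f] with x h1 h2
  rw [h1, h2]
  by_cases hx : x ∈ s <;> simp [hx]

/-- The operator `g ↦ ∫ (χ₋ + p(ξ) χ₀ + q(ξ) χ₊) e_ξ g(ξ) dξ` from `L²(ℝ)` to `L²(Ω)`. -/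
def synthesisOp (α β : ℝ) {p q : ℝ → ℂ} (hp : MemLp p ∞ volume) (hq : MemLp q ∞ volume) :
    L2Line →L[ℂ] L2Ext α β :=
  restrictOp α β ∘L (indicatorOp measurableSet_leftInterval ∘L fourierInvOp
    + indicatorOp (measurableSet_midInterval α) ∘L fourierInvOp ∘L mulOp hp
    + indicatorOp (measurableSet_rightInterval β) ∘L fourierInvOp ∘L mulOp hq)

theorem adjoint_synthesisOp_apply (α β : ℝ) {p q : ℝ → ℂ} (hp : MemLp p ∞ volume)
    (hq : MemLp q ∞ volume) (f : L2Ext α β) :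
    ContinuousLinearMap.adjoint (synthesisOp α β hp hq) f =
      fourierOp (indicatorOp measurableSet_leftInterval
        (ContinuousLinearMap.adjoint (restrictOp α β) f))
      + mulOp (memLp_top_conj hp) (fourierOp (indicatorOp (measurableSet_midInterval α)
        (ContinuousLinearMap.adjoint (restrictOp α β) f)))
      + mulOp (memLp_top_conj hq) (fourierOp (indicatorOp (measurableSet_rightInterval β)
        (ContinuousLinearMap.adjoint (restrictOp α β) f))) := by
  have hF : ContinuousLinearMap.adjoint fourierInvOp = fourierOp := by
    rw [← adjoint_fourierOp, ContinuousLinearMap.adjoint_adjoint]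
  simp only [synthesisOp, ContinuousLinearMap.adjoint_comp, map_add, adjoint_indicatorOp, hF,
    adjoint_mulOp, ContinuousLinearMap.comp_apply, add_apply]

theorem coeFn_fourierOp_indicatorOp {α β : ℝ} {s : Set ℝ} (hs : MeasurableSet s) (f : L2Ext α β)
    (hf : Integrable (f : ℝ → ℂ) (volume.restrict (exterior α β))) :
    fourierOp (indicatorOp hs (ContinuousLinearMap.adjoint (restrictOp α β) f)) =ᵐ[volume]
      fun ξ => ∫ x in exterior α β, conj (e (ξ * x)) * (s.indicator 1 x * f x) := by
  have h1 := coeFn_indicatorOp hs (ContinuousLinearMap.adjoint (restrictOp α β) f)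
  have h2 := coeFn_adjoint_restrictOp α β f
  have h3 : (indicatorOp hs (ContinuousLinearMap.adjoint (restrictOp α β) f) : ℝ → ℂ)
      =ᵐ[volume] s.indicator ((exterior α β).indicator (f : ℝ → ℂ)) := by
    filter_upwards [h1, h2] with x h1 h2
    rw [h1, h2]
    by_cases hx : x ∈ s <;> simp [hx]
  have hi : Integrable (s.indicator ((exterior α β).indicator (f : ℝ → ℂ))) :=
    (IntegrableOn.integrable_indicator hf (measurableSet_exterior α β)).indicator hs
  filter_upwards [coeFn_fourierOp _ (hi.congr h3.symm)] with ξ hξ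
  rw [hξ, ← integral_indicator (measurableSet_exterior α β)]
  refine integral_congr_ae ?_
  filter_upwards [h3] with x hx
  rw [hx]
  by_cases hx1 : x ∈ s <;> by_cases hx2 : x ∈ exterior α β <;> simp [hx1, hx2]

theorem integrable_conj_e_mul_indicator_mul {μ : Measure ℝ} {f : ℝ → ℂ} (hf : Integrable f μ)
    {s : Set ℝ} (hs : MeasurableSet s) (ξ : ℝ) :
    Integrable (fun x => conj (e (ξ * x)) * (s.indicator 1 x * f x)) μ := by
  refine Integrable.bdd_mul (c := 1) ?_ ?_ (.of_forall fun x => ?_)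
  · refine (hf.indicator hs).congr (.of_forall fun x => ?_)
    by_cases hx : x ∈ s <;> simp [hx]
  · simp only [conj_e]
    exact (continuous_e.comp (continuous_const.mul continuous_id).neg).aestronglyMeasurable
  · rw [conj_e, norm_e]

theorem coeFn_add_add {μ : Measure ℝ} (f g h : Lp ℂ 2 μ) :
    (f + g + h : Lp ℂ 2 μ) =ᵐ[μ] fun x => f x + g x + h x := by
  filter_upwards [Lp.coeFn_add (f + g) h, Lp.coeFn_add f g] with x h1 h2
  rw [h1, Pi.add_apply, h2, Pi.add_apply]

/-- Taking the adjoint of synthesis conjugates the kernel, which is the form of analysis against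
`k_ξ`; boundedness then comes for free. On integrable `f` the three pieces are honest Fourier
integrals and can be added. -/
theorem isIntegralTransform_adjoint_synthesisOp (α β : ℝ) {p q : ℝ → ℂ}
    (hp : MemLp p ∞ volume) (hq : MemLp q ∞ volume) :
    IsIntegralTransform α β
      (fun ξ x => (leftInterval.indicator 1 x + p ξ * (midInterval α).indicator 1 x
        + q ξ * (rightInterval β).indicator 1 x) * e (ξ * x))
      (ContinuousLinearMap.adjoint (synthesisOp α β hp hq)) := by
  intro f hf
  rw [adjoint_synthesisOp_apply]
  refine (coeFn_add_add _ _ _).trans ?_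
  have hl := coeFn_fourierOp_indicatorOp measurableSet_leftInterval f hf
  have hm := coeFn_fourierOp_indicatorOp (measurableSet_midInterval α) f hf
  have hr := coeFn_fourierOp_indicatorOp (measurableSet_rightInterval β) f hf
  have hm' := coeFn_mulOp (memLp_top_conj hp)
    (fourierOp (indicatorOp (measurableSet_midInterval α)
      (ContinuousLinearMap.adjoint (restrictOp α β) f)))
  have hr' := coeFn_mulOp (memLp_top_conj hq)
    (fourierOp (indicatorOp (measurableSet_rightInterval β)
      (ContinuousLinearMap.adjoint (restrictOp α β) f)))
  filter_upwards [hl, hm, hr, hm', hr'] with ξ hl hm hr h3 h4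
  have il := integrable_conj_e_mul_indicator_mul hf measurableSet_leftInterval ξ
  have im := integrable_conj_e_mul_indicator_mul hf (measurableSet_midInterval α) ξ
  have ir := integrable_conj_e_mul_indicator_mul hf (measurableSet_rightInterval β) ξ
  have ilm : Integrable (fun x => conj (e (ξ * x)) * (leftInterval.indicator 1 x * f x)
      + conj (p ξ) * (conj (e (ξ * x)) * ((midInterval α).indicator 1 x * f x)))
      (volume.restrict (exterior α β)) := il.add (im.const_mul _)
  rw [h3, h4, hl, hm, hr, ← integral_const_mul,
    ← integral_const_mul, ← integral_add il (im.const_mul _),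
    ← integral_add ilm (ir.const_mul _)]
  refine integral_congr_ae (.of_forall fun x => ?_)
  have hc : ∀ s : Set ℝ, conj (s.indicator (1 : ℝ → ℂ) x) = s.indicator 1 x := fun s => by
    by_cases hx : x ∈ s <;> simp [hx]
  simp only [map_mul, map_add, hc]
  ring

/-! ### The synthesis operator is isometric -/

theorem setIntegral_Ioi_comp_add_right (f : ℝ → ℝ) (b : ℝ) :
    ∫ x in Set.Ioi 0, f (x + b) = ∫ x in Set.Ioi b, f x := by
  rw [← integral_indicator measurableSet_Ioi, ← integral_indicator measurableSet_Ioi,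
    ← integral_add_right_eq_self ((Set.Ioi b).indicator f) b]
  congr 1
  ext x
  by_cases hx : 0 < x <;> simp [Set.indicator, hx]

/-- The components of `Ω` are disjoint, and on each of them only one of the three summands survives.
-/
theorem norm_synthesisOp_sq {α β : ℝ} (hα : 1 < α) (hβ : α < β) {p q : ℝ → ℂ}
    (hp : MemLp p ∞ volume) (hq : MemLp q ∞ volume) (g : L2Line) :
    ‖synthesisOp α β hp hq g‖ ^ 2 =
      (∫ x in Set.Iio 0, ‖fourierInvOp g x‖ ^ 2)
      + (∫ x in Set.Ioo 1 α, ‖fourierInvOp (mulOp hp g) x‖ ^ 2)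
      + ∫ x in Set.Ioi β, ‖fourierInvOp (mulOp hq g) x‖ ^ 2 := by
  set u := synthesisOp α β hp hq g with hu
  have hae : ∀ᵐ x, x ∈ exterior α β → u x =
      leftInterval.indicator 1 x * fourierInvOp g x
      + (midInterval α).indicator 1 x * fourierInvOp (mulOp hp g) x
      + (rightInterval β).indicator 1 x * fourierInvOp (mulOp hq g) x := by
    filter_upwards [ae_imp_of_ae_restrict (coeFn_restrictOp α β
        (indicatorOp measurableSet_leftInterval (fourierInvOp g)
          + indicatorOp (measurableSet_midInterval α) (fourierInvOp (mulOp hp g))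
          + indicatorOp (measurableSet_rightInterval β) (fourierInvOp (mulOp hq g)))),
      coeFn_add_add (indicatorOp measurableSet_leftInterval (fourierInvOp g))
        (indicatorOp (measurableSet_midInterval α) (fourierInvOp (mulOp hp g)))
        (indicatorOp (measurableSet_rightInterval β) (fourierInvOp (mulOp hq g))),
      coeFn_indicatorOp measurableSet_leftInterval (fourierInvOp g),
      coeFn_indicatorOp (measurableSet_midInterval α) (fourierInvOp (mulOp hp g)),
      coeFn_indicatorOp (measurableSet_rightInterval β) (fourierInvOp (mulOp hq g))]
      with x h1 h2 h4 h5 h6 hx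
    rw [← h4, ← h5, ← h6, ← h2]
    exact h1 hx
  have hi : IntegrableOn (fun x => ‖u x‖ ^ 2) (exterior α β) := integrable_norm_sq u
  have d1 : Disjoint (leftInterval ∪ midInterval α) (rightInterval β) := by
    rw [Set.disjoint_left]
    rintro x (hx | hx) hx' <;>
      simp only [leftInterval, midInterval, rightInterval, Set.mem_Iio, Set.mem_Ioo,
        Set.mem_Ioi] at hx hx' <;> linarith
  have d2 : Disjoint leftInterval (midInterval α) := by
    rw [Set.disjoint_left]
    intro x hx hx'
    simp only [leftInterval, midInterval, Set.mem_Iio, Set.mem_Ioo] at hx hx'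
    linarith
  have hu2 : ‖u‖ ^ 2 = ∫ x in leftInterval ∪ midInterval α ∪ rightInterval β, ‖u x‖ ^ 2 :=
    norm_sq_L2_eq_integral u
  rw [hu2, setIntegral_union d1 measurableSet_Ioi (hi.mono_set Set.subset_union_left)
      (hi.mono_set Set.subset_union_right),
    setIntegral_union d2 measurableSet_Ioo
      (hi.mono_set (Set.subset_union_left.trans Set.subset_union_left))
      (hi.mono_set (Set.subset_union_right.trans Set.subset_union_left))]
  congr 1
  · congr 1
    · refine setIntegral_congr_ae measurableSet_Iio ?_
      filter_upwards [hae] with x h hx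
      have h2 : x ∉ midInterval α := Set.disjoint_left.1 d2 hx
      have h3 : x ∉ rightInterval β := Set.disjoint_left.1 d1 (Or.inl hx)
      rw [h (Or.inl (Or.inl hx))]
      simp [h2, h3, show x ∈ leftInterval from hx]
    · refine setIntegral_congr_ae measurableSet_Ioo ?_
      filter_upwards [hae] with x h hx
      have h2 : x ∉ leftInterval := Set.disjoint_right.1 d2 hx
      have h3 : x ∉ rightInterval β := Set.disjoint_left.1 d1 (Or.inr hx)
      rw [h (Or.inl (Or.inr hx))]
      simp [h2, h3, show x ∈ midInterval α from hx]
  · refine setIntegral_congr_ae measurableSet_Ioi ?_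
    filter_upwards [hae] with x h hx
    have h2 : x ∉ leftInterval := fun hl => Set.disjoint_right.1 d1 hx (Or.inl hl)
    have h3 : x ∉ midInterval α := fun hl => Set.disjoint_right.1 d1 hx (Or.inr hl)
    rw [h (Or.inr hx)]
    simp [h2, h3, show x ∈ rightInterval β from hx]

/-- A linear relation between modulated multipliers becomes one between translates. -/
theorem coeFn_fourierInvOp_relation {p q r : ℝ → ℂ} (hp : MemLp p ∞ volume)
    (hq : MemLp q ∞ volume) (hr : MemLp r ∞ volume) {x y z : ℝ} {s t : ℂ}
    (h : ∀ ξ, s * (e (x * ξ) * p ξ) + t * (e (y * ξ) * q ξ) = e (z * ξ) * r ξ) (g : L2Line) :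
    ∀ᵐ v, s * fourierInvOp (mulOp hp g) (v + x) + t * fourierInvOp (mulOp hq g) (v + y)
      = fourierInvOp (mulOp hr g) (v + z) := by
  have key : s • mulOp (memLp_top_e x) (mulOp hp g) + t • mulOp (memLp_top_e y) (mulOp hq g)
      = mulOp (memLp_top_e z) (mulOp hr g) := by
    apply Lp.ext
    filter_upwards [Lp.coeFn_add (s • mulOp (memLp_top_e x) (mulOp hp g))
        (t • mulOp (memLp_top_e y) (mulOp hq g)),
      Lp.coeFn_smul s (mulOp (memLp_top_e x) (mulOp hp g)),
      Lp.coeFn_smul t (mulOp (memLp_top_e y) (mulOp hq g)),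
      coeFn_mulOp (memLp_top_e x) (mulOp hp g), coeFn_mulOp (memLp_top_e y) (mulOp hq g),
      coeFn_mulOp (memLp_top_e z) (mulOp hr g), coeFn_mulOp hp g, coeFn_mulOp hq g,
      coeFn_mulOp hr g] with ξ h1 h2 h3 h4 h5 h6 h7 h8 h9
    rw [h1, Pi.add_apply, h2, h3, Pi.smul_apply, Pi.smul_apply, h4, h5, h6, h7, h8, h9,
      smul_eq_mul, smul_eq_mul]
    linear_combination g ξ * h ξ
  have key2 := congrArg fourierInvOp key
  rw [map_add, map_smul, map_smul, fourierInvOp_mulOp_e, fourierInvOp_mulOp_e,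
    fourierInvOp_mulOp_e] at key2
  have h0 := Lp.coeFn_add (s • translateOp x (fourierInvOp (mulOp hp g)))
    (t • translateOp y (fourierInvOp (mulOp hq g)))
  rw [key2] at h0
  filter_upwards [h0, Lp.coeFn_smul s (translateOp x (fourierInvOp (mulOp hp g))),
    Lp.coeFn_smul t (translateOp y (fourierInvOp (mulOp hq g))),
    coeFn_translateOp x (fourierInvOp (mulOp hp g)),
    coeFn_translateOp y (fourierInvOp (mulOp hq g)),
    coeFn_translateOp z (fourierInvOp (mulOp hr g))] with v h0 h1 h2 h3 h4 h5
  rw [h5, Pi.add_apply, h1, h2, Pi.smul_apply, Pi.smul_apply, h3, h4, smul_eq_mul,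
    smul_eq_mul] at h0
  exact h0.symm

/-- A conservation law: `h₀` and `h₁` become pointwise relations between translates of `G`, `H`,
`K`, and `hb` makes the squared norms on both sides equal. Here `b` plays the role of the boundary
matrix. -/
theorem norm_synthesisOp {α β : ℝ} (hα : 1 < α) (hβ : α < β) {p q : ℝ → ℂ}
    (hp : MemLp p ∞ volume) (hq : MemLp q ∞ volume) {b₀₀ b₀₁ b₁₀ b₁₁ : ℂ}
    (hb : ∀ u v, ‖b₀₀ * u + b₀₁ * v‖ ^ 2 + ‖b₁₀ * u + b₁₁ * v‖ ^ 2 = ‖u‖ ^ 2 + ‖v‖ ^ 2)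
    (h₀ : ∀ ξ, b₀₀ * (e (1 * ξ) * p ξ) + b₀₁ * (e (β * ξ) * q ξ) = e (0 * ξ) * 1)
    (h₁ : ∀ ξ, b₁₀ * (e (1 * ξ) * p ξ) + b₁₁ * (e (β * ξ) * q ξ) = e (α * ξ) * p ξ)
    (g : L2Line) : ‖synthesisOp α β hp hq g‖ = ‖g‖ := by
  have h1 : MemLp (fun _ : ℝ => (1 : ℂ)) ∞ volume := memLp_top_const 1
  have hone : mulOp h1 g = g := by
    apply Lp.ext
    filter_upwards [coeFn_mulOp h1 g] with x hx
    rw [hx, one_mul]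
  have r₀ := coeFn_fourierInvOp_relation hp hq h1 h₀ g
  have r₁ := coeFn_fourierInvOp_relation hp hq hp h₁ g
  rw [hone] at r₀
  set G := fourierInvOp g with hG
  set H := fourierInvOp (mulOp hp g)
  set K := fourierInvOp (mulOp hq g)
  have iG := integrable_norm_sq G
  have iH := integrable_norm_sq H
  have iK := integrable_norm_sq K
  -- Over the half-line, the shifts by `1`, `β`, `0`, `α` produce integrals starting exactly at the
  -- four endpoints of `Ω`.
  have balance : (∫ x in Set.Ioi 0, (‖H (x + 1)‖ ^ 2 + ‖K (x + β)‖ ^ 2))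
      = ∫ x in Set.Ioi 0, (‖G (x + 0)‖ ^ 2 + ‖H (x + α)‖ ^ 2) := by
    refine setIntegral_congr_ae measurableSet_Ioi ?_
    filter_upwards [r₀, r₁] with x h h' _
    rw [← h, ← h', hb]
  rw [integral_add (iH.comp_add_right 1).integrableOn (iK.comp_add_right β).integrableOn,
    integral_add (iG.comp_add_right 0).integrableOn (iH.comp_add_right α).integrableOn,
    setIntegral_Ioi_comp_add_right (fun x => ‖H x‖ ^ 2),
    setIntegral_Ioi_comp_add_right (fun x => ‖K x‖ ^ 2),
    setIntegral_Ioi_comp_add_right (fun x => ‖G x‖ ^ 2),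
    setIntegral_Ioi_comp_add_right (fun x => ‖H x‖ ^ 2)] at balance
  -- The part of `H` beyond `α` occurs on both sides of `balance`, so only the middle interval
  -- remains.
  have split : ∫ x in Set.Ioi 1, ‖H x‖ ^ 2
      = (∫ x in Set.Ioo 1 α, ‖H x‖ ^ 2) + ∫ x in Set.Ioi α, ‖H x‖ ^ 2 := by
    rw [← integral_Ioc_eq_integral_Ioo, ← setIntegral_union (Set.Ioc_disjoint_Ioi le_rfl)
      measurableSet_Ioi iH.integrableOn iH.integrableOn, Set.Ioc_union_Ioi_eq_Ioi hα.le]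
  have splitG : ∫ x, ‖G x‖ ^ 2 = (∫ x in Set.Iio 0, ‖G x‖ ^ 2) + ∫ x in Set.Ioi 0, ‖G x‖ ^ 2 := by
    rw [← integral_Iic_eq_integral_Iio, intervalIntegral.integral_Iic_add_Ioi
      iG.integrableOn iG.integrableOn]
  have hsq : ‖synthesisOp α β hp hq g‖ ^ 2 = ‖g‖ ^ 2 := by
    rw [norm_synthesisOp_sq hα hβ, ← norm_fourierInvOp g, ← hG, norm_sq_L2_eq_integral G, splitG]
    linarith
  exact (sq_eq_sq₀ (norm_nonneg _) (norm_nonneg _)).1 hsq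

/-! ### Uniqueness and change of kernel -/

theorem IsIntegralTransform.unique {α β : ℝ} {k : ℝ → ℝ → ℂ} {V V' : L2Ext α β →L[ℂ] L2Line}
    (h : IsIntegralTransform α β k V) (h' : IsIntegralTransform α β k V') : V = V' :=
  clm_ext_of_integrable fun f hf => (h f hf).trans (h' f hf).symm

/-- The factor depends on `ξ` alone and so leaves the integral; it acts on the conjugated kernel
because that is what is integrated. -/
theorem IsIntegralTransform.mulOp_comp {α β : ℝ} {k k' : ℝ → ℝ → ℂ}
    {V : L2Ext α β →L[ℂ] L2Line} (hV : IsIntegralTransform α β k V) {h : ℝ → ℂ}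
    (hh : MemLp h ∞ volume) (hk : ∀ ξ x, conj (k' ξ x) = h ξ * conj (k ξ x)) :
    IsIntegralTransform α β k' (mulOp hh ∘L V) := by
  intro f hf
  filter_upwards [hV f hf, coeFn_mulOp hh (V f)] with ξ h1 h2
  rw [ContinuousLinearMap.comp_apply, h2, h1, ← integral_const_mul]
  simp only [hk, mul_assoc]

/-! ### The boundary matrix and the coefficients -/

/-- With `one_sub_sqrt_le_norm_one_sub`, this keeps `a` uniformly away from zero, which makes `1/a`
a bounded multiplier. -/
theorem sqrt_one_sub_sq_lt_one {w : ℝ} (hw : 0 < w) : Real.sqrt (1 - w ^ 2) < 1 := by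
  rw [Real.sqrt_lt' one_pos]
  nlinarith

/-- Unitarity of the boundary matrix: the diagonal terms add up by `w² + s² = 1`, and the cross
terms cancel through `c1` and `c2`. -/
theorem boundaryMatrix_norm_sq {w : ℝ} (hw : 0 < w) (hw1 : w ≤ 1) (θ φ ψ : ℝ) (u v : ℂ) :
    ‖(w : ℂ) * e φ * u + -(Real.sqrt (1 - w ^ 2) : ℂ) * e (θ - ψ) * v‖ ^ 2
      + ‖(Real.sqrt (1 - w ^ 2) : ℂ) * e ψ * u + (w : ℂ) * e (θ - φ) * v‖ ^ 2
      = ‖u‖ ^ 2 + ‖v‖ ^ 2 := by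
  have hs : ((Real.sqrt (1 - w ^ 2) : ℝ) : ℂ) ^ 2 = 1 - (w : ℂ) ^ 2 := by
    rw [← Complex.ofReal_pow, Real.sq_sqrt (by nlinarith)]
    push_cast
    ring
  have k : ∀ x, e x * e (-x) = 1 := fun x => by rw [← e_add, add_neg_cancel, e_zero]
  have c1 : e φ * e (-(θ - ψ)) = e ψ * e (-(θ - φ)) := by
    rw [← e_add, ← e_add]; congr 1; ring
  have c2 : e (-φ) * e (θ - ψ) = e (-ψ) * e (θ - φ) := by
    rw [← e_add, ← e_add]; congr 1; ring
  apply Complex.ofReal_injective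
  push_cast
  simp only [← Complex.mul_conj', map_add, map_mul, map_neg, Complex.conj_ofReal, conj_e]
  generalize ((Real.sqrt (1 - w ^ 2) : ℝ) : ℂ) = s at *
  linear_combination (u * conj u) * ((w : ℂ) ^ 2 * k φ + s ^ 2 * k ψ)
    + (v * conj v) * (s ^ 2 * k (θ - ψ) + (w : ℂ) ^ 2 * k (θ - φ))
    + (u * conj u + v * conj v) * hs
    - (w : ℂ) * s * u * conj v * c1 - (w : ℂ) * s * v * conj u * c2

theorem one_sub_sqrt_le_norm_one_sub {w : ℝ} (t : ℝ) :
    1 - Real.sqrt (1 - w ^ 2) ≤ ‖1 - (Real.sqrt (1 - w ^ 2) : ℂ) * e t‖ := by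
  have := norm_sub_norm_le (1 : ℂ) ((Real.sqrt (1 - w ^ 2) : ℂ) * e t)
  rw [norm_mul, norm_e, mul_one, Complex.norm_real, Real.norm_of_nonneg (Real.sqrt_nonneg _),
    norm_one] at this
  exact this

/-- The two numbers are complex conjugates. This is the source of `|a| = |c|`, hence of the
unimodularity of the scattering function. -/
theorem norm_one_sub_mul_e_neg (s t : ℝ) : ‖1 - (s : ℂ) * e (-t)‖ = ‖1 - (s : ℂ) * e t‖ := by
  rw [← Complex.norm_conj]
  simp [conj_e]

end TwoIntervals
end

/-! ### The scattering operator -/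

open TwoIntervals in
theorem theorem5p5 (α β w θ φ ψ : ℝ) (hα : 1 < α) (hβ : α < β) (hw : 0 < w) (hw1 : w ≤ 1)
    (a c : ℝ → ℂ)
    (hac : ∀ ξ : ℝ, IsGenEigenfunction α β (boundaryMatrix w θ φ ψ) ξ
      (planeWave α β (a ξ) (c ξ) ξ)) :
    (∃! V : L2Ext α β →L[ℂ] L2Line, IsIntegralTransform α β (outgoingWave α β a c) V) ∧
    (∃! V : L2Ext α β →L[ℂ] L2Line, IsIntegralTransform α β (incomingWave α β a c) V) ∧
    (∀ Vp Vm : L2Ext α β →L[ℂ] L2Line,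
      IsIntegralTransform α β (outgoingWave α β a c) Vp →
      IsIntegralTransform α β (incomingWave α β a c) Vm →
        scatteringOp Vp Vm ∈ unitary (L2Line →L[ℂ] L2Line) ∧
        ∀ g : L2Line, (scatteringOp Vp Vm g : ℝ → ℂ) =ᵐ[MeasureTheory.volume]
          fun ξ => (a ξ)⁻¹ * c ξ * g ξ) ∧
    ∀ ξ : ℝ, (a ξ)⁻¹ * c ξ = e (-θ - (β - α + 1) * ξ) *
      ((1 - (Real.sqrt (1 - w ^ 2) : ℂ) * e (ψ - (α - 1) * ξ)) /
        (1 - (Real.sqrt (1 - w ^ 2) : ℂ) * e (-ψ + (α - 1) * ξ))) := by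
  have hcoef := fun ξ => (isGenEigenfunction_iff_coeff hα hβ hw hw1 θ φ ψ ξ (a ξ) (c ξ)).1 (hac ξ)
  have hsys := fun ξ => (isGenEigenfunction_planeWave_iff hα hβ _ ξ (a ξ) (c ξ)).1 (hac ξ)
  have hw0 : (w : ℂ) ≠ 0 := by exact_mod_cast hw.ne'
  have hs1 := sqrt_one_sub_sq_lt_one hw
  have hlow := fun t => one_sub_sqrt_le_norm_one_sub (w := w) t
  have hne : ∀ t, 1 - (Real.sqrt (1 - w ^ 2) : ℂ) * e t ≠ 0 := fun t => by
    rw [← norm_pos_iff]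
    linarith [hlow t]
  have ha : ∀ ξ, a ξ ≠ 0 := fun ξ => by
    rw [(hcoef ξ).1]
    exact mul_ne_zero (mul_ne_zero (inv_ne_zero hw0) (e_ne_zero _)) (hne _)
  have hnorm : ∀ ξ, ‖c ξ‖ = ‖a ξ‖ := fun ξ => by
    rw [(hcoef ξ).1, (hcoef ξ).2, norm_mul, norm_mul, norm_mul, norm_mul, norm_e, norm_e,
      ← norm_one_sub_mul_e_neg _ (ψ - (α - 1) * ξ),
      show -(ψ - (α - 1) * ξ) = -ψ + (α - 1) * ξ by ring]
  have hcne : ∀ ξ, c ξ ≠ 0 := fun ξ => by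
    rw [← norm_pos_iff, hnorm, norm_pos_iff]
    exact ha ξ
  have hacont : Continuous a := by
    rw [funext fun ξ => (hcoef ξ).1]
    have := continuous_e
    fun_prop
  have hccont : Continuous c := by
    rw [funext fun ξ => (hcoef ξ).2]
    have := continuous_e
    fun_prop
  have hp : MemLp (fun ξ => (a ξ)⁻¹) ⊤ volume := by
    refine memLp_top_of_continuous_of_bound (hacont.inv₀ ha)
      (C := w * (1 - Real.sqrt (1 - w ^ 2))⁻¹) fun ξ => ?_
    rw [(hcoef ξ).1, norm_inv, norm_mul, norm_mul, norm_e, mul_one, norm_inv, Complex.norm_real,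
      Real.norm_of_nonneg hw.le, mul_inv, inv_inv]
    have : 0 < 1 - Real.sqrt (1 - w ^ 2) := by linarith
    gcongr
    exact hlow _
  have hqn : ∀ ξ, ‖(a ξ)⁻¹ * c ξ‖ = 1 := fun ξ => by
    rw [norm_mul, norm_inv, hnorm, inv_mul_cancel₀ (norm_ne_zero_iff.2 (ha ξ))]
  have hq : MemLp (fun ξ => (a ξ)⁻¹ * c ξ) ⊤ volume :=
    memLp_top_of_continuous_of_bound ((hacont.inv₀ ha).mul hccont) fun ξ => (hqn ξ).le
  set V := ContinuousLinearMap.adjoint (synthesisOp α β hp hq) with hVdef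
  have hV : IsIntegralTransform α β (incomingWave α β a c) V := by
    convert isIntegralTransform_adjoint_synthesisOp α β hp hq using 1
    funext ξ x
    have := inv_mul_cancel₀ (ha ξ)
    rw [incomingWave, planeWave]
    linear_combination leftInterval.indicator 1 x * e (ξ * x) * this
  have hVp : IsIntegralTransform α β (outgoingWave α β a c) (mulOp hq ∘L V) := by
    refine hV.mulOp_comp hq fun ξ x => ?_
    rw [outgoingWave, incomingWave, map_mul, map_mul, map_inv₀, map_inv₀, ← mul_assoc]
    congr 1
    have h1 : conj (a ξ) ≠ 0 := (map_ne_zero _).2 (ha ξ)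
    have h2 : conj (c ξ) ≠ 0 := (map_ne_zero _).2 (hcne ξ)
    -- Equal moduli give `conj (a/c) = c/a`, the factor between the two conjugated kernels.
    have h3 : a ξ * conj (a ξ) = c ξ * conj (c ξ) := by
      rw [Complex.mul_conj', Complex.mul_conj', hnorm]
    have := ha ξ
    field_simp
    linear_combination h3
  -- The two rows of the boundary condition, divided by `a ξ`, are the relations that
  -- `norm_synthesisOp` asks for.
  have hiso : ∀ g, ‖synthesisOp α β hp hq g‖ = ‖g‖ := by
    refine norm_synthesisOp hα hβ hp hq (boundaryMatrix_norm_sq hw hw1 θ φ ψ) (fun ξ => ?_)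
      fun ξ => ?_
    · have h := congrFun (hsys ξ) 0
      simp only [boundaryMatrix, Matrix.mulVec, dotProduct, Fin.sum_univ_two, Matrix.of_apply,
        Matrix.cons_val_zero, Matrix.cons_val_one] at h
      rw [one_mul, zero_mul, e_zero, mul_comm β]
      have := inv_mul_cancel₀ (ha ξ)
      linear_combination (a ξ)⁻¹ * h + this
    · have h := congrFun (hsys ξ) 1
      simp only [boundaryMatrix, Matrix.mulVec, dotProduct, Fin.sum_univ_two, Matrix.of_apply,
        Matrix.cons_val_zero, Matrix.cons_val_one] at h
      rw [one_mul, mul_comm β, mul_comm α]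
      linear_combination (a ξ)⁻¹ * h
  have hVV : V ∘L ContinuousLinearMap.adjoint V = 1 := by
    rw [hVdef, ContinuousLinearMap.adjoint_adjoint]
    exact (ContinuousLinearMap.norm_map_iff_adjoint_comp_self _).1 hiso
  refine ⟨⟨_, hVp, fun _ h => h.unique hVp⟩, ⟨V, hV, fun _ h => h.unique hV⟩, ?_, ?_⟩
  · intro Vp Vm h1 h2
    have hS : scatteringOp Vp Vm = mulOp hq := by
      rw [h1.unique hVp, h2.unique hV, scatteringOp, ContinuousLinearMap.comp_assoc, hVV]
      rfl
    rw [hS]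
    exact ⟨mulOp_mem_unitary hq hqn, coeFn_mulOp hq⟩
  · intro ξ
    -- Splits off the phase `e (φ + ξ)` of `a`, so that it cancels in the quotient and `φ`
    -- disappears.
    have h1 : e (-θ - (β - α + 1) * ξ) * e (φ + ξ) = e (φ - θ - (β - α) * ξ) := by
      rw [← e_add]
      congr 1
      ring
    rw [(hcoef ξ).1, (hcoef ξ).2, ← h1]
    have h2 := hne (-ψ + (α - 1) * ξ)
    have h3 := e_ne_zero (φ + ξ)
    field_simp
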